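/- Let $\mathcal I$ be a finite set and let $(B(t))_{t\ge 0}$ be a time-homogeneous continuous-time Markov process on $\mathcal I$ with right-continuous paths and infinitesimal generator (transition rate matrix) $Q$; write $\mathbb P_s,\mathbb E_s$ for probability and expectation given $B(0)=s$. Let $v:\mathcal I\to(0,\infty)$ be the strictly positive state-dependent speed, $V=\mathrm{diag}\{(v(s))_{s\in\mathcal I}\}$, and for $d\ge 0$ let $$\tau(d)=\min\Big\{t\ge 0:\int_0^t v(B(u))\,du\ge d\Big\}$$ be the time needed to travel the distance $d$. For $s,s'\in\mathcal I$, $d\ge 0$ and $\alpha\in\mathbb C$ put $$\phi_s(d)=\mathbb E_s[\tau(d)],\quad \Phi(d)=(\phi_s(d))_{s\in\mathcal I},\qquad \psi_{ss'}(d\,|\,\alpha)=\mathbb E_s\big[e^{-\alpha\tau(d)}1\{B(\tau(d))=s'\}\big],\quad \Psi(d\,|\,\alpha)=(\psi_{ss'}(d\,|\,\alpha))_{s,s'\in\mathcal I}.$$ Then the minimum defining $\tau(d)$ is attained, these expectations exist and are finite, $\Phi$ and $\Psi(\cdot\,|\,\alpha)$ are differentiable on $[0,\infty)$ (from the right at $d=0$),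 and for all $d\ge 0$ and $\alpha\in\mathbb C$ $$V\,\Phi'(d)=\mathbf 1+Q\,\Phi(d),\qquad V\,\Psi'(d\,|\,\alpha)=(Q-\alpha I)\,\Psi(d\,|\,\alpha),$$ where $\mathbf 1$ is the all-ones column vector and the derivative is with respect to $d$. Moreover, for all $d\ge 0$ and $\alpha\in\mathbb C$, $$\Phi(d)=\begin{bmatrix} I & \mathbf 0\end{bmatrix}\exp\left\{\begin{bmatrix} dV^{-1}Q & dV^{-1}\mathbf 1\\ \mathbf 0^\top & 0\end{bmatrix}\right\}\begin{bmatrix}\mathbf 0\\ 1\end{bmatrix},\qquad \Psi(d\,|\,\alpha)=\exp\{d\,V^{-1}(Q-\alpha I)\}.$$ -/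

import Mathlib

open MeasureTheory Set Filter Topology
open scoped NNReal Matrix

noncomputable section

/-- `p` is a (standard) transition function on the finite state space `I` with infinitesimal
generator (transition rate matrix) `Q`: a semigroup of stochastic matrices whose right derivative
at time `0` is `Q`. -/
structure IsTransitionFunction {I : Type*} [Fintype I] [DecidableEq I]
    (Q : Matrix I I ℝ) (p : ℝ≥0 → Matrix I I ℝ) : Prop where
  nonneg : ∀ t i j, 0 ≤ p t i j
  row_sum : ∀ t i, ∑ j, p t i j = 1
  zero : p 0 = 1
  add : ∀ t h, p (t + h) = p t * p h
  generator : ∀ i j,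
    Tendsto (fun h : ℝ≥0 => (p h i j - (1 : Matrix I I ℝ) i j) / (h : ℝ)) (𝓝[>] 0) (𝓝 (Q i j))

/-- The σ-algebra generated by `(B u)`, `0 ≤ u ≤ t`. -/
abbrev pastSigma {Ω I : Type*} (B : ℝ≥0 → Ω → I) (t : ℝ≥0) : MeasurableSpace Ω :=
  ⨆ u ∈ Iic t, MeasurableSpace.comap (B u) ⊤

/-- `(B t)` is, under the probability measures `P s`, `s ∈ I`, a time-homogeneous continuous-time
Markov process on the finite state space `I` with generator `Q` and right-continuous paths (for the
discrete topology); `P s` is the law under which the process starts in `s`, so that integration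
against `P s` is expectation conditional on `B 0 = s`. -/
structure IsMarkovProcess {Ω I : Type*} [MeasurableSpace Ω] [Fintype I] [DecidableEq I]
    (Q : Matrix I I ℝ) (P : I → Measure Ω) (B : ℝ≥0 → Ω → I) : Prop where
  isProbabilityMeasure : ∀ s, IsProbabilityMeasure (P s)
  measurable : ∀ t, Measurable[_, ⊤] (B t)
  right_continuous : ∀ ω t, ∀ᶠ u in 𝓝[≥] t, B u ω = B t ω
  start : ∀ s, ∀ᵐ ω ∂(P s), B 0 ω = s
  markov : ∃ p, IsTransitionFunction Q p ∧
    ∀ (s : I) (t h : ℝ≥0) (E : Set Ω), MeasurableSet[pastSigma B t] E → ∀ j,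
      (P s).real (E ∩ {ω | B (t + h) ω = j}) = ∑ i, (P s).real (E ∩ {ω | B t ω = i}) * p h i j

/-- Distance travelled up to time `t` at speed `v (B u)` at time `u`. -/
def travelledDistance {Ω I : Type*} (v : I → ℝ) (B : ℝ≥0 → Ω → I) (t : ℝ≥0) (ω : Ω) : ℝ :=
  ∫ u in (0 : ℝ)..t, v (B u.toNNReal ω)

/-- The time needed to travel the distance `d`. -/
def travelTime {Ω I : Type*} (v : I → ℝ) (B : ℝ≥0 → Ω → I) (d : ℝ) (ω : Ω) : ℝ≥0 :=
  sInf {t : ℝ≥0 | d ≤ travelledDistance v B t ω}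

/-- The integrand `e^{-α τ(d)} 1{B(τ(d)) = s'}`. -/
def transformIntegrand {Ω I : Type*} (v : I → ℝ) (B : ℝ≥0 → Ω → I) (α : ℂ) (d : ℝ) (s' : I) :
    Ω → ℂ :=
  {ω | B (travelTime v B d ω) ω = s'}.indicator
    fun ω => Complex.exp (-α * ((travelTime v B d ω : ℝ) : ℂ))

/-- `Φ(d)`: the vector of expected travel times, indexed by the initial background state. -/
def Phi {Ω I : Type*} [MeasurableSpace Ω] (P : I → Measure Ω) (v : I → ℝ) (B : ℝ≥0 → Ω → I)
    (d : ℝ) : I → ℝ :=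
  fun s => ∫ ω, (travelTime v B d ω : ℝ) ∂(P s)

/-- `Ψ(d | α)`: the matrix of Laplace–Stieltjes transforms of the travel time, intersected with the
final background state. -/
def Psi {Ω I : Type*} [MeasurableSpace Ω] (P : I → Measure Ω) (v : I → ℝ) (B : ℝ≥0 → Ω → I)
    (α : ℂ) (d : ℝ) : Matrix I I ℂ :=
  Matrix.of fun s s' => ∫ ω, transformIntegrand v B α d s' ω ∂(P s)

end

/-! ### Path regularity, the travelled distance and its inverse, the travel time. -/

section Paths

variable {Ω I : Type*} {v : I → ℝ} {B : ℝ≥0 → Ω → I}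

/-! Let `D t` be the travelled distance and let `F i (t, y)` be `C¹` functions with `∂ₜ F i - v i ∂ᵧ
F i + ∑ j, Q i j F j = 0`. Then `M t = F (B t) (t, d - D t)` has zero drift: time grows at rate `1`,
the remaining distance shrinks at rate `v (B t)`, and jumps contribute the generator term. The
travel time `τ` is a stopping time, bounded by `d / min v`, and `D τ = d`. Dynkin's formula
therefore gives `E_s[F (B τ) (τ, 0)] = F s (0, d)` (`integrable_and_integral_travelTime_eq`).

Two choices of `F` give the explicit formulas. With `A = V⁻¹(Q - α)`, the functions `exp(-α t) ·
exp(y A) i s'` yield `Ψ`; with the block matrix `travelTimeMatrix`, the functions `t + exp(y ·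
travelTimeMatrix) (inl i) (inr ())` yield `Φ`. The differential equations then follow by
differentiating matrix exponentials.

Dynkin's formula is proved by discretisation. Rounding `τ` up to a grid of mesh `h` writes `M` at
the rounded time as a sum of increments on the past events `{k h < τ}`. By the Markov property each
increment has integral at most a constant times `ε h` (`norm_setIntegral_step_le`). There are about
`1 / h` of them, so the total vanishes as the grid is refined. Right-continuity and dominated
convergence identify the limit. -/

theorem measurable_pastSigma (B : ℝ≥0 → Ω → I) {t u : ℝ≥0} (h : u ≤ t) :
    Measurable[pastSigma B t, ⊤] (B u) :=
  Measurable.of_comap_le (le_iSup₂_of_le u h le_rfl)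

theorem pastSigma_le [mΩ : MeasurableSpace Ω] (hB : ∀ t, Measurable[_, ⊤] (B t)) (t : ℝ≥0) :
    pastSigma B t ≤ mΩ :=
  iSup₂_le fun w _ => (hB w).comap_le

/-- The smallest point of the grid of mesh `1 / (n + 1)` that is at least `x`. -/
noncomputable def gridCeil (n : ℕ) (x : ℝ≥0) : ℝ≥0 :=
  (⌈((n : ℝ≥0) + 1) * x⌉₊ : ℝ≥0) / ((n : ℝ≥0) + 1)

theorem le_gridCeil (n : ℕ) (x : ℝ≥0) : x ≤ gridCeil n x := by
  rw [gridCeil, le_div_iff₀ (by positivity), mul_comm]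
  exact Nat.le_ceil _

theorem gridCeil_le (n : ℕ) (x : ℝ≥0) : gridCeil n x ≤ x + 1 / ((n : ℝ≥0) + 1) := by
  rw [gridCeil, div_le_iff₀ (by positivity), add_mul x, one_div,
    inv_mul_cancel₀ (by positivity), mul_comm x]
  exact (Nat.ceil_lt_add_one (by positivity)).le

/-- Convergence in `𝓝[≥] x` is what right-continuity acts on: along the rounded times the state is
eventually equal to the state at `x`. -/
theorem tendsto_gridCeil (x : ℝ≥0) : Tendsto (fun n => gridCeil n x) atTop (𝓝[≥] x) := by
  refine tendsto_nhdsWithin_iff.2 ⟨?_, Eventually.of_forall fun n => le_gridCeil n x⟩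
  refine tendsto_of_tendsto_of_tendsto_of_le_of_le tendsto_const_nhds ?_
    (fun n => le_gridCeil n x) (fun n => gridCeil_le n x)
  have : Tendsto (fun n : ℕ => x + 1 / ((n : ℝ≥0) + 1)) atTop (𝓝 (x + 0)) :=
    tendsto_const_nhds.add tendsto_one_div_add_atTop_nhds_zero_nat
  simpa using this

/-- A right-continuous process on a discrete space is progressively measurable. -/
theorem measurable_uncurry_min [MeasurableSpace Ω]
    (hr : ∀ ω t, ∀ᶠ u in 𝓝[≥] t, B u ω = B t ω) {t : ℝ≥0}
    (hm : ∀ u ≤ t, Measurable[_, ⊤] (B u)) (v : I → ℝ) :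
    Measurable fun p : ℝ × Ω => v (B (min p.1.toNNReal t) p.2) := by
  refine measurable_of_tendsto_metrizable
    (f := fun n (p : ℝ × Ω) => v (B (min (gridCeil n p.1.toNNReal) t) p.2)) (fun n => ?_) ?_
  · have h1 : Measurable fun q : ℕ × Ω =>
        v (B (min ((q.1 : ℝ≥0) / ((n : ℝ≥0) + 1)) t) q.2) := by
      refine measurable_from_prod_countable_right fun k => ?_
      exact (measurable_from_top (f := v)).comp
        (hm (min ((k : ℝ≥0) / ((n : ℝ≥0) + 1)) t) (min_le_right _ _))
    have h2 : Measurable fun p : ℝ × Ω => ((n : ℝ≥0) + 1) * p.1.toNNReal :=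
      measurable_fst.real_toNNReal.const_mul _
    have h3 := h1.comp ((Nat.measurable_ceil.comp h2).prodMk measurable_snd)
    simp only [Function.comp_def] at h3
    simp only [gridCeil]
    exact h3
  · refine tendsto_pi_nhds.2 fun p => ?_
    have h : Tendsto (fun n => min (gridCeil n p.1.toNNReal) t) atTop
        (𝓝[≥] (min p.1.toNNReal t)) := by
      refine tendsto_nhdsWithin_iff.2 ⟨?_, Eventually.of_forall fun n =>
        min_le_min_right t (le_gridCeil n _)⟩
      exact ((tendsto_gridCeil p.1.toNNReal).mono_right nhdsWithin_le_nhds).min tendsto_const_nhds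
    refine tendsto_const_nhds.congr' ?_
    filter_upwards [h.eventually (hr p.2 _)] with n hn
    rw [hn]

theorem measurable_path (hr : ∀ ω t, ∀ᶠ u in 𝓝[≥] t, B u ω = B t ω) (v : I → ℝ) (ω : Ω) :
    Measurable fun u : ℝ => v (B u.toNNReal ω) := by
  refine measurable_of_tendsto_metrizable
    (f := fun n (u : ℝ) => v (B (gridCeil n u.toNNReal) ω)) (fun n => ?_) ?_
  · have h1 : Measurable fun k : ℕ => v (B ((k : ℝ≥0) / ((n : ℝ≥0) + 1)) ω) := measurable_from_top
    exact h1.comp (Nat.measurable_ceil.comp ((measurable_id.real_toNNReal).const_mul _))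
  · refine tendsto_pi_nhds.2 fun u => tendsto_const_nhds.congr' ?_
    filter_upwards [(tendsto_gridCeil u.toNNReal).eventually (hr ω _)] with n hn
    rw [hn]

theorem intervalIntegrable_path [Finite I] (hr : ∀ ω t, ∀ᶠ u in 𝓝[≥] t, B u ω = B t ω)
    (v : I → ℝ) (ω : Ω) (a b : ℝ) :
    IntervalIntegrable (fun u : ℝ => v (B u.toNNReal ω)) volume a b := by
  obtain ⟨C, hC⟩ := (Set.finite_range fun i => ‖v i‖).bddAbove
  refine (intervalIntegrable_const (c := C)).mono_fun
    (measurable_path hr v ω).aestronglyMeasurable (Eventually.of_forall fun u => ?_)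
  exact (hC ⟨_, rfl⟩).trans (le_abs_self C)

theorem travelledDistance_sub [Finite I] (hr : ∀ ω t, ∀ᶠ u in 𝓝[≥] t, B u ω = B t ω)
    (v : I → ℝ) (ω : Ω) (s t : ℝ≥0) :
    travelledDistance v B t ω - travelledDistance v B s ω
      = ∫ u in (s : ℝ)..t, v (B u.toNNReal ω) :=
  intervalIntegral.integral_interval_sub_left (intervalIntegrable_path hr v ω _ _)
    (intervalIntegrable_path hr v ω _ _)

theorem le_travelledDistance_sub [Finite I] (hr : ∀ ω t, ∀ᶠ u in 𝓝[≥] t, B u ω = B t ω)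
    {c : ℝ} (hc : ∀ i, c ≤ v i) (ω : Ω) {s t : ℝ≥0} (hst : s ≤ t) :
    c * (t - s) ≤ travelledDistance v B t ω - travelledDistance v B s ω := by
  rw [travelledDistance_sub hr]
  calc c * (t - s) = ∫ _u in (s : ℝ)..t, c := by simp [mul_comm]
    _ ≤ _ := intervalIntegral.integral_mono_on (by exact_mod_cast hst) intervalIntegrable_const
        (intervalIntegrable_path hr v ω _ _) fun u _ => hc _

theorem travelledDistance_sub_le [Finite I] (hr : ∀ ω t, ∀ᶠ u in 𝓝[≥] t, B u ω = B t ω)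
    {c : ℝ} (hc : ∀ i, v i ≤ c) (ω : Ω) {s t : ℝ≥0} (hst : s ≤ t) :
    travelledDistance v B t ω - travelledDistance v B s ω ≤ c * (t - s) := by
  rw [travelledDistance_sub hr]
  calc _ ≤ ∫ _u in (s : ℝ)..t, c := intervalIntegral.integral_mono_on (by exact_mod_cast hst)
        (intervalIntegrable_path hr v ω _ _) intervalIntegrable_const fun u _ => hc _
    _ = c * (t - s) := by simp [mul_comm]

theorem travelledDistance_zero (v : I → ℝ) (B : ℝ≥0 → Ω → I) (ω : Ω) :
    travelledDistance v B 0 ω = 0 := by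
  simp [travelledDistance]

theorem continuous_travelledDistance [Finite I] (hr : ∀ ω t, ∀ᶠ u in 𝓝[≥] t, B u ω = B t ω)
    (v : I → ℝ) (ω : Ω) : Continuous fun t : ℝ≥0 => travelledDistance v B t ω :=
  (intervalIntegral.continuous_primitive (fun a b => intervalIntegrable_path hr v ω a b) 0).comp
    NNReal.continuous_coe

/-- The σ-algebra on `Ω` is arbitrary and only times up to `t` enter, so the lemma also applies with
`pastSigma B t`: the travelled distance is adapted. -/
theorem measurable_travelledDistance [MeasurableSpace Ω]
    (hr : ∀ ω t, ∀ᶠ u in 𝓝[≥] t, B u ω = B t ω) {t : ℝ≥0}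
    (hm : ∀ u ≤ t, Measurable[_, ⊤] (B u)) (v : I → ℝ) :
    Measurable (travelledDistance v B t) := by
  have h : travelledDistance v B t = fun ω =>
      ∫ u in Ioc (0 : ℝ) t, v (B (min u.toNNReal t) ω) := by
    ext ω
    rw [travelledDistance, intervalIntegral.integral_of_le (NNReal.coe_nonneg t)]
    refine setIntegral_congr_fun measurableSet_Ioc fun u hu => ?_
    rw [min_eq_left (Real.toNNReal_le_iff_le_coe.2 hu.2)]
  rw [h]
  exact ((measurable_uncurry_min hr hm v).stronglyMeasurable.integral_prod_left'
    (μ := volume.restrict (Ioc (0 : ℝ) t))).measurable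

theorem travelledDistance_mono [Finite I] (hr : ∀ ω t, ∀ᶠ u in 𝓝[≥] t, B u ω = B t ω)
    (hv : ∀ i, 0 < v i) (ω : Ω) : Monotone fun t : ℝ≥0 => travelledDistance v B t ω := by
  intro s t hst
  have := le_travelledDistance_sub hr (fun i => (hv i).le) ω hst
  rw [zero_mul] at this
  exact sub_nonneg.1 this

theorem exists_pos_le [Finite I] (hv : ∀ i, 0 < v i) : ∃ c, 0 < c ∧ ∀ i, c ≤ v i := by
  cases isEmpty_or_nonempty I
  · exact ⟨1, one_pos, fun i => isEmptyElim i⟩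
  · obtain ⟨i, hi⟩ := Finite.exists_min v
    exact ⟨v i, hv i, hi⟩

theorem le_travelledDistance_of_le [Finite I] (hr : ∀ ω t, ∀ᶠ u in 𝓝[≥] t, B u ω = B t ω)
    {c : ℝ} (hc0 : 0 < c) (hc : ∀ i, c ≤ v i) (ω : Ω) {d : ℝ} {t : ℝ≥0} (ht : d / c ≤ t) :
    d ≤ travelledDistance v B t ω := by
  have h := le_travelledDistance_sub hr hc ω (zero_le (a := t))
  rw [travelledDistance_zero, sub_zero, NNReal.coe_zero, sub_zero] at h
  rw [div_le_iff₀ hc0, mul_comm] at ht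
  exact ht.trans h

theorem isLeast_travelTime [Finite I] (hr : ∀ ω t, ∀ᶠ u in 𝓝[≥] t, B u ω = B t ω)
    (hv : ∀ i, 0 < v i) (d : ℝ) (ω : Ω) :
    IsLeast {t : ℝ≥0 | d ≤ travelledDistance v B t ω} (travelTime v B d ω) := by
  obtain ⟨c, hc0, hc⟩ := exists_pos_le hv
  have hcl : IsClosed {t : ℝ≥0 | d ≤ travelledDistance v B t ω} :=
    isClosed_le continuous_const (continuous_travelledDistance hr v ω)
  exact ⟨hcl.csInf_mem ⟨(d / c).toNNReal,
    le_travelledDistance_of_le hr hc0 hc ω (Real.le_coe_toNNReal _)⟩ (OrderBot.bddBelow _),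
    fun t ht => csInf_le (OrderBot.bddBelow _) ht⟩

/-- Turns events about the travel time into events about the distance at a fixed time; this makes
the travel time a stopping time. -/
theorem travelTime_le_iff [Finite I] (hr : ∀ ω t, ∀ᶠ u in 𝓝[≥] t, B u ω = B t ω)
    (hv : ∀ i, 0 < v i) {d : ℝ} {ω : Ω} {t : ℝ≥0} :
    travelTime v B d ω ≤ t ↔ d ≤ travelledDistance v B t ω :=
  ⟨fun h => (isLeast_travelTime hr hv d ω).1.trans (travelledDistance_mono hr hv ω h),
    fun h => (isLeast_travelTime hr hv d ω).2 h⟩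

theorem travelledDistance_travelTime [Finite I] (hr : ∀ ω t, ∀ᶠ u in 𝓝[≥] t, B u ω = B t ω)
    (hv : ∀ i, 0 < v i) {d : ℝ} (hd : 0 ≤ d) (ω : Ω) :
    travelledDistance v B (travelTime v B d ω) ω = d := by
  have hL := isLeast_travelTime hr hv d ω
  obtain ⟨t, ht, h⟩ := intermediate_value_Icc (zero_le (a := travelTime v B d ω))
    (continuous_travelledDistance hr v ω).continuousOn
    ⟨(travelledDistance_zero v B ω).le.trans hd, hL.1⟩
  rwa [le_antisymm ht.2 (hL.2 h.ge)] at h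

end Paths

/-! ### Small-time expansion of the transition function. -/

section TransitionFunction

variable {I : Type*} [Fintype I] [DecidableEq I] {Q : Matrix I I ℝ} {p : ℝ≥0 → Matrix I I ℝ}

/-- Differentiate the constant row sums of `p` at time `0`. This makes `Q` annihilate the summand
`t` in the functions used for `Φ`. -/
theorem IsTransitionFunction.row_sum_generator (hp : IsTransitionFunction Q p) (i : I) :
    ∑ j, Q i j = 0 := by
  have h1 : Tendsto (fun h : ℝ≥0 => ∑ j, (p h i j - (1 : Matrix I I ℝ) i j) / (h : ℝ)) (𝓝[>] 0)
      (𝓝 (∑ j, Q i j)) := tendsto_finsetSum _ fun j _ => hp.generator i j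
  refine tendsto_nhds_unique h1 (tendsto_const_nhds.congr fun h => ?_)
  rw [← Finset.sum_div, Finset.sum_sub_distrib, hp.row_sum]
  simp [Matrix.one_apply]

/-- One threshold `η` serves all entries and all `h ≤ η`. The first bound controls the probability
of a state change, the second the error of replacing `p h` by `1 + h Q`. -/
theorem IsTransitionFunction.exists_expansion (hp : IsTransitionFunction Q p) {ε : ℝ}
    (hε : 0 < ε) :
    ∃ η : ℝ≥0, 0 < η ∧ ∀ h, h ≤ η →
      ∑ i, ∑ j, |p h i j - (1 : Matrix I I ℝ) i j| ≤ ε ∧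
      ∑ i, ∑ j, |p h i j - (1 : Matrix I I ℝ) i j - h * Q i j| ≤ ε * h := by
  have hid : Tendsto (fun h : ℝ≥0 => (h : ℝ)) (𝓝[>] 0) (𝓝 0) :=
    (NNReal.continuous_coe.tendsto 0).mono_left nhdsWithin_le_nhds
  have hpos : ∀ᶠ h : ℝ≥0 in 𝓝[>] 0, (0 : ℝ) < h :=
    eventually_mem_nhdsWithin.mono fun h (hh : 0 < h) => hh
  have h1 : Tendsto (fun h : ℝ≥0 => ∑ i, ∑ j, |p h i j - (1 : Matrix I I ℝ) i j|) (𝓝[>] 0)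
      (𝓝 0) := by
    have : Tendsto (fun h : ℝ≥0 => ∑ i, ∑ j,
        |(p h i j - (1 : Matrix I I ℝ) i j) / h * h|) (𝓝[>] 0) (𝓝 (∑ i, ∑ j, |Q i j * 0|)) :=
      tendsto_finsetSum _ fun i _ => tendsto_finsetSum _ fun j _ =>
        ((hp.generator i j).mul hid).abs
    simp only [mul_zero, abs_zero, Finset.sum_const_zero] at this
    refine this.congr' ?_
    filter_upwards [hpos] with h hh
    simp only [div_mul_cancel₀ _ hh.ne']
  have h2 : Tendsto (fun h : ℝ≥0 => ∑ i, ∑ j,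
      |(p h i j - (1 : Matrix I I ℝ) i j) / h - Q i j|) (𝓝[>] 0) (𝓝 0) := by
    have : Tendsto (fun h : ℝ≥0 => ∑ i, ∑ j,
        |(p h i j - (1 : Matrix I I ℝ) i j) / h - Q i j|) (𝓝[>] 0)
          (𝓝 (∑ i, ∑ j, |Q i j - Q i j|)) :=
      tendsto_finsetSum _ fun i _ => tendsto_finsetSum _ fun j _ =>
        ((hp.generator i j).sub_const _).abs
    simpa using this
  have h3 := (h1.eventually (ge_mem_nhds hε)).and (h2.eventually (ge_mem_nhds hε))
  obtain ⟨η, hη, hsub⟩ := (mem_nhdsGT_iff_exists_Ioc_subset).1 h3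
  refine ⟨η, hη, fun h hle => ?_⟩
  rcases eq_or_lt_of_le (zero_le (a := h)) with rfl | hh
  · simp [hp.zero, hε.le]
  · obtain ⟨ha, hb⟩ := hsub ⟨hh, hle⟩
    refine ⟨ha, ?_⟩
    have hh' : (0 : ℝ) < h := hh
    have h4 := mul_le_mul_of_nonneg_right hb hh'.le
    rw [Finset.sum_mul] at h4
    refine le_trans (le_of_eq (Finset.sum_congr rfl fun i _ => ?_)) h4
    rw [Finset.sum_mul]
    refine Finset.sum_congr rfl fun j _ => ?_
    rw [← abs_of_pos hh', ← abs_mul, abs_of_pos hh', sub_mul, div_mul_cancel₀ _ hh'.ne',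
      mul_comm (Q i j)]

end TransitionFunction

/-! ### Random variables indexed by a random state. -/

section RandomIndex

variable {Ω I E : Type*} [NormedAddCommGroup E]

theorem measurableSet_fiber [MeasurableSpace Ω] {b : Ω → I} (hb : Measurable[_, ⊤] b) (i : I) :
    MeasurableSet {ω | b ω = i} := hb (MeasurableSpace.measurableSet_top (s := {i}))

variable [Fintype I]

theorem apply_eq_sum_indicator (b : Ω → I) (Y : I → Ω → E) (ω : Ω) :
    Y (b ω) ω = ∑ i, {ω | b ω = i}.indicator (Y i) ω := by
  classical
  simp [Set.indicator_apply]

theorem stronglyMeasurable_apply [MeasurableSpace Ω] {b : Ω → I} (hb : Measurable[_, ⊤] b)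
    {Y : I → Ω → E} (hY : ∀ i, StronglyMeasurable (Y i)) :
    StronglyMeasurable fun ω => Y (b ω) ω := by
  simp_rw [apply_eq_sum_indicator b Y]
  exact Finset.stronglyMeasurable_fun_sum _ fun i _ => (hY i).indicator (measurableSet_fiber hb i)

theorem integrable_apply [MeasurableSpace Ω] {μ : Measure Ω} {b : Ω → I}
    (hb : Measurable[_, ⊤] b) {Y : I → Ω → E} (hY : ∀ i, Integrable (Y i) μ) :
    Integrable (fun ω => Y (b ω) ω) μ := by
  simp_rw [apply_eq_sum_indicator b Y]
  exact integrable_finsetSum _ fun i _ => (hY i).indicator (measurableSet_fiber hb i)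

theorem integral_apply_eq_sum [NormedSpace ℝ E] [MeasurableSpace Ω] {μ : Measure Ω} {b : Ω → I}
    (hb : Measurable[_, ⊤] b) {Y : I → Ω → E} (hY : ∀ i, Integrable (Y i) μ) :
    ∫ ω, Y (b ω) ω ∂μ = ∑ i, ∫ ω in {ω | b ω = i}, Y i ω ∂μ := by
  simp_rw [apply_eq_sum_indicator b Y]
  rw [integral_finsetSum _ fun i _ => (hY i).indicator (measurableSet_fiber hb i)]
  exact Finset.sum_congr rfl fun i _ => integral_indicator (measurableSet_fiber hb i)

end RandomIndex

/-! ### The Markov property for integrals. -/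

section Markov

variable {Ω I E : Type*} [mΩ : MeasurableSpace Ω] [Fintype I] [NormedAddCommGroup E]
  [NormedSpace ℝ E] {B : ℝ≥0 → Ω → I} {μ : Measure Ω} [IsProbabilityMeasure μ]
  {p : ℝ≥0 → Matrix I I ℝ} {t h : ℝ≥0}

/-- For events of the past, the Markov property says that two finite measures on `pastSigma B t`
agree. Integrating `X` against both gives the claim. -/
theorem setIntegral_eq_sum_of_markov (hB : ∀ t, Measurable[_, ⊤] (B t))
    (hp : ∀ i j, 0 ≤ p h i j)
    (hM : ∀ S : Set Ω, MeasurableSet[pastSigma B t] S → ∀ j,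
      μ.real (S ∩ {ω | B (t + h) ω = j}) = ∑ i, μ.real (S ∩ {ω | B t ω = i}) * p h i j)
    {X : Ω → E} (hX : StronglyMeasurable[pastSigma B t] X) (hXi : Integrable X μ) (j : I) :
    ∫ ω in {ω | B (t + h) ω = j}, X ω ∂μ = ∑ i, p h i j • ∫ ω in {ω | B t ω = i}, X ω ∂μ := by
  have hm := pastSigma_le hB t
  have key : (μ.restrict {ω | B (t + h) ω = j}).trim hm =
      ∑ i, (p h i j).toNNReal • (μ.restrict {ω | B t ω = i}).trim hm := by
    refine @Measure.ext _ (pastSigma B t) _ _ fun S hS => ?_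
    rw [trim_measurableSet_eq hm hS, Measure.restrict_apply (hm _ hS), Measure.finsetSum_apply]
    simp only [Measure.smul_apply, trim_measurableSet_eq hm hS, Measure.restrict_apply (hm _ hS)]
    have h1 := hM S hS j
    rw [← ENNReal.toReal_eq_toReal_iff' (measure_ne_top _ _)
      (ENNReal.sum_ne_top.2 fun i _ => by
        rw [ENNReal.smul_def, smul_eq_mul]
        exact ENNReal.mul_ne_top ENNReal.coe_ne_top (measure_ne_top _ _)),
      ENNReal.toReal_sum fun i _ => by
        rw [ENNReal.smul_def, smul_eq_mul]
        exact ENNReal.mul_ne_top ENNReal.coe_ne_top (measure_ne_top _ _)]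
    refine h1.trans (Finset.sum_congr rfl fun i _ => ?_)
    rw [ENNReal.smul_def, smul_eq_mul, ENNReal.toReal_mul, ENNReal.coe_toReal,
      Real.coe_toNNReal _ (hp i j), mul_comm]
    rfl
  rw [integral_trim hm hX, key, integral_finsetSum_measure]
  · refine Finset.sum_congr rfl fun i _ => ?_
    rw [integral_smul_nnreal_measure, ← integral_trim hm hX, NNReal.smul_def,
      Real.coe_toNNReal _ (hp i j)]
  · intro i _
    exact ((hXi.mono_measure Measure.restrict_le_self).trim hm hX).smul_measure_nnreal

theorem integral_apply_of_markov (hB : ∀ t, Measurable[_, ⊤] (B t))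
    (hp : ∀ i j, 0 ≤ p h i j)
    (hM : ∀ S : Set Ω, MeasurableSet[pastSigma B t] S → ∀ j,
      μ.real (S ∩ {ω | B (t + h) ω = j}) = ∑ i, μ.real (S ∩ {ω | B t ω = i}) * p h i j)
    {Y : I → Ω → E} (hY : ∀ j, StronglyMeasurable[pastSigma B t] (Y j))
    (hYi : ∀ j, Integrable (Y j) μ) :
    ∫ ω, Y (B (t + h) ω) ω ∂μ = ∫ ω, ∑ j, p h (B t ω) j • Y j ω ∂μ := by
  have h1 := integral_apply_eq_sum (μ := μ) (hB t) (Y := fun i ω => ∑ j, p h i j • Y j ω)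
    fun i => integrable_finsetSum _ fun j _ => (hYi j).smul (p h i j)
  rw [integral_apply_eq_sum (hB _) hYi, h1]
  simp_rw [setIntegral_eq_sum_of_markov hB hp hM (hY _) (hYi _)]
  rw [Finset.sum_comm]
  refine Finset.sum_congr rfl fun i _ => ?_
  rw [integral_finsetSum (f := fun j ω => p h i j • Y j ω) _ fun j _ =>
    ((hYi j).mono_measure Measure.restrict_le_self).smul (p h i j)]
  exact Finset.sum_congr rfl fun j _ => (integral_smul _ _).symm

variable [DecidableEq I]

/-- From state `i`, the probability of being elsewhere after time `h` is the sum of the off-diagonal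
entries in row `i` of `p h`, which are entries of `p h - 1`. -/
theorem integral_ite_ne_le_of_markov (hB : ∀ t, Measurable[_, ⊤] (B t))
    (hp : ∀ i j, 0 ≤ p h i j)
    (hM : ∀ S : Set Ω, MeasurableSet[pastSigma B t] S → ∀ j,
      μ.real (S ∩ {ω | B (t + h) ω = j}) = ∑ i, μ.real (S ∩ {ω | B t ω = i}) * p h i j) :
    ∫ ω, (if B t ω = B (t + h) ω then 0 else 1 : ℝ) ∂μ
      ≤ ∑ i, ∑ j, |p h i j - (1 : Matrix I I ℝ) i j| := by
  have hY : ∀ j, StronglyMeasurable[pastSigma B t]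
      fun ω => (if B t ω = j then 0 else 1 : ℝ) := fun j =>
    StronglyMeasurable.ite (measurable_pastSigma B le_rfl
      (MeasurableSpace.measurableSet_top (s := {j}))) stronglyMeasurable_const
      stronglyMeasurable_const
  rw [integral_apply_of_markov (Y := fun j ω => (if B t ω = j then 0 else 1 : ℝ)) hB hp hM hY
    fun j => Integrable.of_bound ((hY j).mono (pastSigma_le hB t)).aestronglyMeasurable 1
      (Eventually.of_forall fun ω => by split_ifs <;> simp)]
  refine (integral_mono_of_nonneg (g := fun _ => ∑ i, ∑ j, |p h i j - (1 : Matrix I I ℝ) i j|)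
    (Eventually.of_forall fun ω => ?_)
    (integrable_const _) (Eventually.of_forall fun ω => ?_)).trans (by simp)
  · exact Finset.sum_nonneg fun j _ => smul_nonneg (hp _ _) (by split_ifs <;> simp)
  · refine le_trans ?_ (Finset.single_le_sum (fun i _ => Finset.sum_nonneg fun j _ =>
      abs_nonneg (p h i j - (1 : Matrix I I ℝ) i j)) (Finset.mem_univ (B t ω)))
    refine Finset.sum_le_sum fun j _ => ?_
    by_cases hj : B t ω = j
    · simp [hj]
    · simp [hj, le_abs_self]

/-- Averaging over the new state replaces `Y (B (t + h) ω) ω` by row `B t ω` of `p h` applied to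
`Y`; what remains is that row of `p h - 1 - h Q`. -/
theorem norm_integral_increment_le_of_markov (hB : ∀ t, Measurable[_, ⊤] (B t))
    (hp : ∀ i j, 0 ≤ p h i j)
    (hM : ∀ S : Set Ω, MeasurableSet[pastSigma B t] S → ∀ j,
      μ.real (S ∩ {ω | B (t + h) ω = j}) = ∑ i, μ.real (S ∩ {ω | B t ω = i}) * p h i j)
    (Q : Matrix I I ℝ) {Y : I → Ω → E} (hY : ∀ j, StronglyMeasurable[pastSigma B t] (Y j))
    {K : ℝ} (hK : ∀ j ω, ‖Y j ω‖ ≤ K) :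
    ‖∫ ω, (Y (B (t + h) ω) ω - Y (B t ω) ω - (h : ℝ) • ∑ j, Q (B t ω) j • Y j ω) ∂μ‖
      ≤ (∑ i, ∑ j, |p h i j - (1 : Matrix I I ℝ) i j - h * Q i j|) * K := by
  have hY' := fun j => (hY j).mono (pastSigma_le hB t)
  have hYi : ∀ j, Integrable (Y j) μ := fun j =>
    Integrable.of_bound (hY' j).aestronglyMeasurable K (Eventually.of_forall (hK j))
  have hYb : ∀ u, Integrable (fun ω => Y (B u ω) ω) μ := fun u =>
    Integrable.of_bound (stronglyMeasurable_apply (hB u) hY').aestronglyMeasurable K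
      (Eventually.of_forall fun ω => hK _ ω)
  have hS : ∀ A : Matrix I I ℝ, Integrable (fun ω => ∑ j, A (B t ω) j • Y j ω) μ := by
    exact fun A => integrable_apply (Y := fun i ω => ∑ j, A i j • Y j ω) (hB t) fun i =>
      integrable_finsetSum _ fun j _ => (hYi j).smul (A i j)
  have hQ : Integrable (fun ω => (h : ℝ) • ∑ j, Q (B t ω) j • Y j ω) μ := (hS Q).smul (h : ℝ)
  have hD : Integrable (fun ω => Y (B (t + h) ω) ω - Y (B t ω) ω) μ := (hYb _).sub (hYb _)
  have hD' : Integrable (fun ω => ∑ j, p h (B t ω) j • Y j ω - Y (B t ω) ω) μ :=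
    (hS (p h)).sub (hYb _)
  rw [integral_sub hD hQ, integral_sub (hYb _) (hYb _),
    integral_apply_of_markov hB hp hM hY hYi, ← integral_sub (hS (p h)) (hYb _),
    ← integral_sub hD' hQ]
  refine (norm_integral_le_of_norm_le_const (C := (∑ i, ∑ j,
    |p h i j - (1 : Matrix I I ℝ) i j - h * Q i j|) * K)
    (Eventually.of_forall fun ω => ?_)).trans (by simp)
  have h1 : ∑ j, p h (B t ω) j • Y j ω - Y (B t ω) ω - (h : ℝ) • ∑ j, Q (B t ω) j • Y j ω
      = ∑ j, (p h (B t ω) j - (1 : Matrix I I ℝ) (B t ω) j - h * Q (B t ω) j) • Y j ω := by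
    simp only [sub_smul, Finset.sum_sub_distrib, Finset.smul_sum, mul_smul, Matrix.one_apply,
      ite_smul, one_smul, zero_smul, Finset.sum_ite_eq, Finset.mem_univ, if_true]
  have hK0 : 0 ≤ K := (norm_nonneg _).trans (hK (B t ω) ω)
  rw [h1]
  calc _ ≤ ∑ j, |p h (B t ω) j - (1 : Matrix I I ℝ) (B t ω) j - h * Q (B t ω) j| * K :=
        norm_sum_le_of_le _ fun j _ => by
          rw [norm_smul, Real.norm_eq_abs]
          exact mul_le_mul_of_nonneg_left (hK j ω) (abs_nonneg _)
    _ ≤ _ := by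
        rw [← Finset.sum_mul]
        refine mul_le_mul_of_nonneg_right ?_ hK0
        exact Finset.single_le_sum (f := fun i => ∑ j,
          |p h i j - (1 : Matrix I I ℝ) i j - h * Q i j|)
          (fun i _ => Finset.sum_nonneg fun j _ => abs_nonneg _) (Finset.mem_univ (B t ω))

end Markov

/-! ### Uniform first-order Taylor expansion. -/

section Taylor

variable {G E : Type*} [NormedAddCommGroup G] [NormedSpace ℝ G] [ProperSpace G]
  [NormedAddCommGroup E] [NormedSpace ℝ E]

/-- First order Taylor expansion of a `C¹` function, uniformly on a closed ball. -/
theorem ContDiff.exists_norm_sub_sub_fderiv_le {f : G → E} (hf : ContDiff ℝ 1 f) (R : ℝ) {ε : ℝ}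
    (hε : 0 < ε) :
    ∃ η : ℝ, 0 < η ∧ ∀ z w, ‖z‖ ≤ R → ‖w‖ ≤ R → ‖w - z‖ ≤ η →
      ‖f w - f z - fderiv ℝ f z (w - z)‖ ≤ ε * ‖w - z‖ := by
  have huc := (isCompact_closedBall (0 : G) R).uniformContinuousOn_of_continuous
    (hf.continuous_fderiv one_ne_zero).continuousOn
  obtain ⟨δ, hδ, h⟩ := Metric.uniformContinuousOn_iff_le.1 huc ε hε
  refine ⟨δ, hδ, fun z w hz hw hwz => ?_⟩
  have hd : Differentiable ℝ f := hf.differentiable one_ne_zero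
  -- Mean value inequality on a convex set where the derivative stays within `ε` of its value at
  -- `z`.
  refine Convex.norm_image_sub_le_of_norm_fderiv_le'
    (s := Metric.closedBall 0 R ∩ Metric.closedBall z δ) (fun x _ => hd x) (fun x hx => ?_)
    ((convex_closedBall _ _).inter (convex_closedBall _ _))
    ⟨mem_closedBall_zero_iff.2 hz, Metric.mem_closedBall_self hδ.le⟩
    ⟨mem_closedBall_zero_iff.2 hw, by rwa [mem_closedBall_iff_norm]⟩
  rw [← dist_eq_norm]
  exact h x hx.1 z (mem_closedBall_zero_iff.2 hz) hx.2

end Taylor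

/-! ### The drift of `M` over one grid step is negligible. -/

section Step

variable {Ω I E : Type*} [mΩ : MeasurableSpace Ω] [Fintype I] [DecidableEq I]
  {B : ℝ≥0 → Ω → I} {μ : Measure Ω} [IsProbabilityMeasure μ] {v : I → ℝ} {C ε : ℝ} {t h : ℝ≥0}

/-- The error is at most the integral over `u` of `|v (B u) - v (B t)|`, which is at most `2 * C`
and vanishes unless the state at `u` differs from that at `t`. Fubini and `hκ` finish. -/
theorem integral_abs_travelledDistance_sub_le (hB : ∀ t, Measurable[_, ⊤] (B t))
    (hr : ∀ ω t, ∀ᶠ u in 𝓝[≥] t, B u ω = B t ω) (hC : ∀ i, |v i| ≤ C) (hC0 : 0 ≤ C)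
    (hκ : ∀ u ≤ h, ∫ ω, (if B t ω = B (t + u) ω then 0 else 1 : ℝ) ∂μ ≤ ε) :
    ∫ ω, |travelledDistance v B (t + h) ω - travelledDistance v B t ω - h * v (B t ω)| ∂μ
      ≤ 2 * C * ε * h := by
  have hth : (t : ℝ) ≤ ((t + h : ℝ≥0) : ℝ) := by simp
  let g : ℝ × Ω → ℝ := fun q => |v (B (min q.1.toNNReal (t + h)) q.2) - v (B t q.2)|
  have hgm : Measurable g := by
    have h1 : Measurable fun q : ℝ × Ω => v (B t q.2) :=
      ((measurable_from_top (f := v)).comp (hB t)).comp measurable_snd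
    exact ((measurable_uncurry_min hr (fun u _ => hB u) v).sub h1).abs
  have hg2 : ∀ q, g q ≤ 2 * C := fun q => (abs_sub _ _).trans (by
    have := hC (B (min q.1.toNNReal (t + h)) q.2)
    have := hC (B t q.2)
    linarith)
  have hgi : Integrable g ((volume.restrict (Ioc (t : ℝ) (t + h : ℝ≥0))).prod μ) :=
    Integrable.of_bound hgm.aestronglyMeasurable (2 * C) (Eventually.of_forall fun q => by
      rw [Real.norm_eq_abs, abs_abs]; exact hg2 q)
  have h1 : ∀ ω, |travelledDistance v B (t + h) ω - travelledDistance v B t ω - h * v (B t ω)|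
      ≤ ∫ u in Ioc (t : ℝ) (t + h : ℝ≥0), g (u, ω) := by
    intro ω
    have h2 : (h : ℝ) * v (B t ω) = ∫ _u in (t : ℝ)..(t + h : ℝ≥0), v (B t ω) := by simp
    rw [travelledDistance_sub hr, h2, ← intervalIntegral.integral_sub
      (intervalIntegrable_path hr v ω _ _) intervalIntegrable_const]
    refine (intervalIntegral.abs_integral_le_integral_abs hth).trans (le_of_eq ?_)
    rw [intervalIntegral.integral_of_le hth]
    refine setIntegral_congr_fun measurableSet_Ioc fun u hu => ?_
    simp only [g]
    rw [min_eq_left (Real.toNNReal_le_iff_le_coe.2 hu.2)]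
  have h3 : ∀ u ∈ Ioc (t : ℝ) (t + h : ℝ≥0), ∫ ω, g (u, ω) ∂μ ≤ 2 * C * ε := by
    intro u hu
    have hut : t ≤ u.toNNReal := NNReal.le_toNNReal_of_coe_le hu.1.le
    have huh : u.toNNReal ≤ t + h := Real.toNNReal_le_iff_le_coe.2 hu.2
    have hk := hκ (u.toNNReal - t) (tsub_le_iff_left.2 huh)
    rw [add_tsub_cancel_of_le hut] at hk
    refine le_trans ?_ (mul_le_mul_of_nonneg_left hk (by positivity))
    rw [← integral_const_mul]
    refine integral_mono_of_nonneg (Eventually.of_forall fun ω => abs_nonneg _) ?_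
      (Eventually.of_forall fun ω => ?_)
    · refine Integrable.const_mul ?_ _
      refine integrable_apply (Y := fun i ω => if i = B u.toNNReal ω then (0 : ℝ) else 1)
        (hB t) fun i => ?_
      exact integrable_apply (Y := fun j _ => if i = j then (0 : ℝ) else 1) (hB _)
        fun j => integrable_const _
    · simp only [g]
      rw [min_eq_left huh]
      split_ifs with hb
      · simp [hb]
      · have := hg2 (u, ω)
        simp only [g] at this
        rwa [min_eq_left huh, ← mul_one (2 * C)] at this
  calc _ ≤ ∫ ω, (∫ u in Ioc (t : ℝ) (t + h : ℝ≥0), g (u, ω)) ∂μ :=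
        integral_mono_of_nonneg (Eventually.of_forall fun ω => abs_nonneg _)
          hgi.swap.integral_prod_left (Eventually.of_forall h1)
    _ = ∫ u in Ioc (t : ℝ) (t + h : ℝ≥0), (∫ ω, g (u, ω) ∂μ) :=
        (integral_integral_swap (f := fun u ω => g (u, ω)) hgi).symm
    _ ≤ ∫ _u in Ioc (t : ℝ) (t + h : ℝ≥0), 2 * C * ε :=
        setIntegral_mono_on hgi.integral_prod_left (integrable_const _) measurableSet_Ioc h3
    _ = 2 * C * ε * h := by simp [mul_comm]

variable [NormedAddCommGroup E] [NormedSpace ℝ E]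

/-- The increment splits into a change of state at the old point `z`, handled by the Markov
property, and a move from `z` to `z'`, handled by Taylor. Their leading terms cancel by `hpde`. -/
theorem norm_setIntegral_step_le {Q : Matrix I I ℝ} {p : ℝ≥0 → Matrix I I ℝ}
    (hB : ∀ t, Measurable[_, ⊤] (B t)) (hr : ∀ ω t, ∀ᶠ u in 𝓝[≥] t, B u ω = B t ω)
    (hp : ∀ h i j, 0 ≤ p h i j)
    (hM : ∀ (t h : ℝ≥0) (S : Set Ω), MeasurableSet[pastSigma B t] S → ∀ j,
      μ.real (S ∩ {ω | B (t + h) ω = j}) = ∑ i, μ.real (S ∩ {ω | B t ω = i}) * p h i j)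
    {F : I → ℝ × ℝ → E} {F' : I → ℝ × ℝ → ℝ × ℝ →L[ℝ] E} (hF : ∀ i, Continuous (F i))
    (hpde : ∀ i z, F' i z (1, -v i) + ∑ j, Q i j • F j z = 0)
    {R K η d : ℝ} (hK : ∀ i z, ‖z‖ ≤ R → ‖F i z‖ ≤ K) (hK' : ∀ i z, ‖z‖ ≤ R → ‖F' i z‖ ≤ K)
    (hT : ∀ i z w, ‖z‖ ≤ R → ‖w‖ ≤ R → ‖w - z‖ ≤ η →
      ‖F i w - F i z - F' i z (w - z)‖ ≤ ε * ‖w - z‖)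
    (hC : ∀ i, |v i| ≤ C) (hC0 : 0 ≤ C) (hK0 : 0 ≤ K) (hε : 0 ≤ ε) (hη : (C + 1) * h ≤ η)
    (hp1 : ∀ u ≤ h, ∑ i, ∑ j, |p u i j - (1 : Matrix I I ℝ) i j| ≤ ε)
    (hp2 : ∑ i, ∑ j, |p h i j - (1 : Matrix I I ℝ) i j - h * Q i j| ≤ ε * h)
    (hz : ∀ ω, ‖((t : ℝ), d - travelledDistance v B t ω)‖ ≤ R)
    (hz' : ∀ ω, ‖(((t + h : ℝ≥0) : ℝ), d - travelledDistance v B (t + h) ω)‖ ≤ R)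
    {S : Set Ω} (hS : MeasurableSet[pastSigma B t] S) :
    ‖∫ ω in S, (F (B (t + h) ω) (((t + h : ℝ≥0) : ℝ), d - travelledDistance v B (t + h) ω)
        - F (B t ω) ((t : ℝ), d - travelledDistance v B t ω)) ∂μ‖
      ≤ ε * h * ((C + 1) + 2 * K * (C + 1) + 2 * C * K + K) := by
  set z : Ω → ℝ × ℝ := fun ω => ((t : ℝ), d - travelledDistance v B t ω) with hzdef
  set z' : Ω → ℝ × ℝ := fun ω => (((t + h : ℝ≥0) : ℝ), d - travelledDistance v B (t + h) ω)
    with hz'def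
  have hS' := pastSigma_le hB t _ hS
  have hzm : @Measurable _ _ (pastSigma B t) _ z :=
    measurable_const.prodMk (measurable_const.sub
      (@measurable_travelledDistance _ _ B (pastSigma B t) hr t
        (fun u hu => measurable_pastSigma B hu) v))
  have hz'm : Measurable z' :=
    measurable_const.prodMk (measurable_const.sub
      (measurable_travelledDistance hr (fun u _ => hB u) v))
  have hFz : ∀ j, StronglyMeasurable[pastSigma B t] fun ω => F j (z ω) := fun j =>
    (hF j).stronglyMeasurable.comp_measurable hzm
  have hFzi : ∀ j, Integrable (fun ω => F j (z ω)) μ := fun j =>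
    Integrable.of_bound ((hFz j).mono (pastSigma_le hB t)).aestronglyMeasurable K
      (Eventually.of_forall fun ω => hK _ _ (hz ω))
  have hFzi' : ∀ j, Integrable (fun ω => F j (z' ω)) μ := fun j =>
    Integrable.of_bound ((hF j).stronglyMeasurable.comp_measurable hz'm).aestronglyMeasurable K
      (Eventually.of_forall fun ω => hK _ _ (hz' ω))
  have hMi := integrable_apply (hB t) hFzi
  have hMi' := integrable_apply (hB (t + h)) hFzi'
  -- The jump part of the increment, compensated by its generator term.
  let r : Ω → E := fun ω => F (B (t + h) ω) (z ω) - F (B t ω) (z ω)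
    - (h : ℝ) • ∑ j, Q (B t ω) j • F j (z ω)
  have hri : Integrable r μ :=
    ((integrable_apply (hB _) hFzi).sub hMi).sub ((integrable_apply
      (Y := fun i ω => ∑ j, Q i j • F j (z ω)) (hB t) fun i =>
        integrable_finsetSum _ fun j _ => (hFzi j).smul (Q i j)).smul (h : ℝ))
  have hr1 : ‖∫ ω in S, r ω ∂μ‖ ≤ ε * h * K := by
    rw [← integral_indicator hS']
    -- Since `S` is a past event, its indicator can be absorbed into the functions `Y j`.
    have := norm_integral_increment_le_of_markov hB (hp h) (hM t h) Q
      (Y := fun j => S.indicator fun ω => F j (z ω)) (K := K)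
      (fun j => (hFz j).indicator hS) (fun j ω => by
        refine (norm_indicator_le_norm_self _ _).trans (hK _ _ (hz ω)))
    refine le_trans (le_of_eq ?_) (this.trans (mul_le_mul_of_nonneg_right hp2 hK0))
    congr 2
    ext ω
    by_cases hω : ω ∈ S <;> simp [hω, r]
  -- Three pointwise errors: the Taylor remainder, the wrong derivative `F' j` after a state change,
  -- and the deviation of the distance from `h * v (B t ω)`.
  let g : Ω → ℝ := fun ω => ε * ((C + 1) * h)
    + (2 * K * (C + 1) * h) * (if B t ω = B (t + h) ω then 0 else 1 : ℝ)
    + K * |travelledDistance v B (t + h) ω - travelledDistance v B t ω - h * v (B t ω)|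
  have hi1 : Integrable (fun ω => (if B t ω = B (t + h) ω then 0 else 1 : ℝ)) μ :=
    integrable_apply (Y := fun i ω => if i = B (t + h) ω then (0 : ℝ) else 1) (hB t)
      fun i => integrable_apply (Y := fun j _ => if i = j then (0 : ℝ) else 1) (hB _)
        fun j => integrable_const _
  have hD1 : ∀ ω, |travelledDistance v B (t + h) ω - travelledDistance v B t ω| ≤ C * h := by
    intro ω
    rw [abs_le]
    have h1 := travelledDistance_sub_le hr (fun i => (abs_le.1 (hC i)).2) ω
      (le_self_add : t ≤ t + h)
    have h2 := le_travelledDistance_sub hr (fun i => (abs_le.1 (hC i)).1) ω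
      (le_self_add : t ≤ t + h)
    push_cast at h1 h2
    constructor <;> linarith
  have hv1 : ∀ ω, |h * v (B t ω)| ≤ C * h := fun ω => by
    rw [abs_mul, NNReal.abs_eq, mul_comm]
    exact mul_le_mul_of_nonneg_right (hC _) h.2
  have hi2 : Integrable (fun ω =>
      |travelledDistance v B (t + h) ω - travelledDistance v B t ω - h * v (B t ω)|) μ := by
    refine Integrable.of_bound (C := 2 * C * h) (Measurable.aestronglyMeasurable ?_)
      (Eventually.of_forall fun ω => ?_)
    · exact (((measurable_travelledDistance hr (fun u _ => hB u) v).sub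
        (measurable_travelledDistance hr (fun u _ => hB u) v)).sub
          (((measurable_from_top (f := v)).comp (hB t)).const_mul _)).abs
    · rw [Real.norm_eq_abs, abs_abs]
      refine (abs_sub _ _).trans ?_
      linarith [hD1 ω, hv1 ω]
  have hgi : Integrable g μ :=
    ((integrable_const _).add (hi1.const_mul _)).add (hi2.const_mul _)
  have hgle : ∫ ω, g ω ∂μ ≤ ε * h * ((C + 1) + 2 * K * (C + 1) + 2 * C * K) := by
    have h1 : ∫ ω, g ω ∂μ = ε * ((C + 1) * h)
        + (2 * K * (C + 1) * h) * ∫ ω, (if B t ω = B (t + h) ω then 0 else 1 : ℝ) ∂μ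
        + K * ∫ ω, |travelledDistance v B (t + h) ω - travelledDistance v B t ω
          - h * v (B t ω)| ∂μ := by
      have e1 : Integrable (fun ω => ε * ((C + 1) * h)
        + (2 * K * (C + 1) * h) * (if B t ω = B (t + h) ω then 0 else 1 : ℝ)) μ :=
        (integrable_const _).add (hi1.const_mul _)
      simp only [g]
      rw [integral_add e1 (hi2.const_mul _), integral_add (integrable_const _) (hi1.const_mul _),
        integral_const, probReal_univ, one_smul, integral_const_mul, integral_const_mul]
    have hκ : ∀ u ≤ h, ∫ ω, (if B t ω = B (t + u) ω then 0 else 1 : ℝ) ∂μ ≤ ε := fun u hu =>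
      (integral_ite_ne_le_of_markov hB (hp u) (hM t u)).trans (hp1 u hu)
    have h2 := mul_le_mul_of_nonneg_left (hκ h le_rfl)
      (show 0 ≤ 2 * K * (C + 1) * h by positivity)
    have h3 := mul_le_mul_of_nonneg_left
      (integral_abs_travelledDistance_sub_le hB hr hC hC0 hκ) hK0
    rw [h1]
    nlinarith [h2, h3]
  have hpt : ∀ ω, ‖F (B (t + h) ω) (z' ω) - F (B t ω) (z ω) - r ω‖ ≤ g ω := by
    intro ω
    set i := B t ω with hi
    set j := B (t + h) ω with hj
    set a := travelledDistance v B (t + h) ω - travelledDistance v B t ω with ha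
    have hw : z' ω - z ω = ((h : ℝ), -a) := by
      simp only [hzdef, hz'def, Prod.mk_sub_mk, NNReal.coe_add, ha]
      congr 1 <;> ring
    have hwn : ‖z' ω - z ω‖ ≤ (C + 1) * h := by
      rw [hw, Prod.norm_mk, Real.norm_eq_abs, Real.norm_eq_abs, abs_neg, NNReal.abs_eq]
      have hh := h.2
      refine max_le ?_ ((hD1 ω).trans ?_)
      · nlinarith
      · nlinarith
    have hR1 : ‖F j (z' ω) - F j (z ω) - F' j (z ω) (z' ω - z ω)‖ ≤ ε * ((C + 1) * h) :=
      (hT j _ _ (hz ω) (hz' ω) (hwn.trans hη)).trans (mul_le_mul_of_nonneg_left hwn hε)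
    have hR2 : ‖F' j (z ω) (z' ω - z ω) - F' i (z ω) ((h : ℝ), -(h * v i))‖
        ≤ (2 * K * (C + 1) * h) * (if i = j then 0 else 1 : ℝ) + K * |a - h * v i| := by
      split_ifs with hij
      · rw [← hij, ← map_sub, mul_zero, zero_add]
        refine ((F' i (z ω)).le_of_opNorm_le (hK' i _ (hz ω)) _).trans (le_of_eq ?_)
        rw [hw, Prod.mk_sub_mk, sub_self, Prod.norm_mk, norm_zero,
          max_eq_right (norm_nonneg _), Real.norm_eq_abs, ← abs_neg]
        congr 2
        ring
      · have hn2 : ‖((h : ℝ), -(h * v i))‖ ≤ (C + 1) * h := by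
          rw [Prod.norm_mk, Real.norm_eq_abs, Real.norm_eq_abs, abs_neg, NNReal.abs_eq]
          have hh := h.2
          refine max_le ?_ ((hv1 ω).trans ?_)
          · nlinarith
          · nlinarith
        have e1 := ((F' j (z ω)).le_of_opNorm_le (hK' j _ (hz ω)) (z' ω - z ω)).trans
          (mul_le_mul_of_nonneg_left hwn hK0)
        have e2 := ((F' i (z ω)).le_of_opNorm_le (hK' i _ (hz ω)) ((h : ℝ), -(h * v i))).trans
          (mul_le_mul_of_nonneg_left hn2 hK0)
        have e3 : 0 ≤ K * |a - h * v i| := by positivity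
        refine (norm_sub_le _ _).trans ?_
        linarith
    -- The transport derivative cancels the generator term subtracted in `r`.
    have hR3 : F' i (z ω) ((h : ℝ), -(h * v i)) = -((h : ℝ) • ∑ j, Q i j • F j (z ω)) := by
      have e1 : ((h : ℝ), -(h * v i)) = (h : ℝ) • ((1 : ℝ), -v i) := by
        rw [Prod.smul_mk, smul_eq_mul, smul_eq_mul, mul_one, mul_neg]
      rw [e1, map_smul, ← smul_neg, eq_neg_of_add_eq_zero_left (hpde i (z ω))]
    have e : F j (z' ω) - F i (z ω) - r ω
        = (F j (z' ω) - F j (z ω) - F' j (z ω) (z' ω - z ω))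
          + (F' j (z ω) (z' ω - z ω) - F' i (z ω) ((h : ℝ), -(h * v i))) := by
      rw [hR3]
      simp only [r]
      abel
    rw [e]
    refine (norm_add_le _ _).trans ?_
    simp only [g]
    rw [← hi, ← hj, ← ha]
    linarith
  have hd : Integrable (fun ω => F (B (t + h) ω) (z' ω) - F (B t ω) (z ω)) μ := hMi'.sub hMi
  have hsplit : ∫ ω in S, (F (B (t + h) ω) (z' ω) - F (B t ω) (z ω)) ∂μ
      = ∫ ω in S, (F (B (t + h) ω) (z' ω) - F (B t ω) (z ω) - r ω) ∂μ + ∫ ω in S, r ω ∂μ := by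
    rw [integral_sub hd.integrableOn hri.integrableOn, sub_add_cancel]
  have h5 : ‖∫ ω in S, (F (B (t + h) ω) (z' ω) - F (B t ω) (z ω) - r ω) ∂μ‖ ≤ ∫ ω, g ω ∂μ :=
    (norm_integral_le_of_norm_le hgi.integrableOn (Eventually.of_forall hpt)).trans
      (setIntegral_le_integral hgi (Eventually.of_forall fun ω => (norm_nonneg _).trans (hpt ω)))
  rw [hsplit]
  refine (norm_add_le _ _).trans ((add_le_add (h5.trans hgle) hr1).trans (le_of_eq (by ring)))

end Step

/-! ### Dynkin's formula at the travel time. -/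

section Dynkin

variable {Ω I E : Type*} [MeasurableSpace Ω] [Fintype I] [DecidableEq I]
  [NormedAddCommGroup E] {B : ℝ≥0 → Ω → I}

theorem lt_ceil_mul_iff {n k : ℕ} {x : ℝ≥0} :
    k < ⌈((n : ℝ≥0) + 1) * x⌉₊ ↔ (k : ℝ≥0) / ((n : ℝ≥0) + 1) < x := by
  rw [Nat.lt_ceil, div_lt_iff₀ (by positivity), mul_comm]

/-- A path evaluated at a grid approximation of `x` is a sum of increments over the grid. -/
theorem apply_gridCeil_eq_sum (f : ℝ≥0 → E) (n N : ℕ) {x : ℝ≥0}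
    (hN : ⌈((n : ℝ≥0) + 1) * x⌉₊ ≤ N) :
    f (gridCeil n x) = f 0 + ∑ k ∈ Finset.range N,
      if (k : ℝ≥0) / ((n : ℝ≥0) + 1) < x then
        f ((k : ℝ≥0) / ((n : ℝ≥0) + 1) + 1 / ((n : ℝ≥0) + 1)) - f ((k : ℝ≥0) / ((n : ℝ≥0) + 1))
      else 0 := by
  have h1 : ∀ m : ℕ, f ((m : ℝ≥0) / ((n : ℝ≥0) + 1)) = f 0 + ∑ k ∈ Finset.range m,
      (f ((k : ℝ≥0) / ((n : ℝ≥0) + 1) + 1 / ((n : ℝ≥0) + 1))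
        - f ((k : ℝ≥0) / ((n : ℝ≥0) + 1))) := by
    intro m
    have := Finset.sum_range_sub (fun k : ℕ => f ((k : ℝ≥0) / ((n : ℝ≥0) + 1))) m
    simp only [Nat.cast_add, Nat.cast_one, add_div, Nat.cast_zero, zero_div] at this
    simp only [← add_div] at this ⊢
    rw [this]
    abel
  rw [gridCeil, h1, ← Finset.sum_filter]
  congr 1
  refine Finset.sum_congr ?_ fun _ _ => rfl
  ext k
  simp only [Finset.mem_range, Finset.mem_filter, ← lt_ceil_mul_iff]
  exact ⟨fun h => ⟨h.trans_le hN, h⟩, fun h => h.2⟩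

/-- Dynkin's formula at the time at which the distance `d` has been travelled. -/
theorem integrable_and_integral_travelTime_eq [NormedSpace ℝ E] [CompleteSpace E]
    {Q : Matrix I I ℝ} {P : I → Measure Ω} (hB : IsMarkovProcess Q P B) {v : I → ℝ} (hv : ∀ s, 0 < v s) {F : I → ℝ × ℝ → E}
    (hF : ∀ i, ContDiff ℝ 1 (F i))
    (hpde : ∀ i z, fderiv ℝ (F i) z (1, -v i) + ∑ j, Q i j • F j z = 0)
    {d : ℝ} (hd : 0 ≤ d) (s : I) :
    Integrable (fun ω => F (B (travelTime v B d ω) ω) ((travelTime v B d ω : ℝ), 0)) (P s) ∧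
    ∫ ω, F (B (travelTime v B d ω) ω) ((travelTime v B d ω : ℝ), 0) ∂(P s) = F s (0, d) := by
  have hr := hB.right_continuous
  have hm := hB.measurable
  obtain ⟨p, hp, hM⟩ := hB.markov
  replace hM := hM s
  have hprob := hB.isProbabilityMeasure s
  obtain ⟨c, hc0, hc⟩ := exists_pos_le hv
  obtain ⟨C, hC⟩ := (Set.finite_range fun i => |v i|).bddAbove
  replace hC : ∀ i, |v i| ≤ C := fun i => hC ⟨i, rfl⟩
  have hC0 : 0 ≤ C := (abs_nonneg _).trans (hC s)
  have hF0 := fun i => (hF i).continuous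
  set T : ℝ≥0 := (d / c).toNNReal with hT
  have hτT : ∀ ω, travelTime v B d ω ≤ T := fun ω => (travelTime_le_iff hr hv).2
    (le_travelledDistance_of_le hr hc0 hc ω (Real.le_coe_toNNReal _))
  -- Rounding up overshoots `T` by at most `1`, so all points met up to time `T + 1` lie in the ball
  -- of radius `R`.
  set R : ℝ := (T + 1) + d + C * (T + 1) with hR
  have hz : ∀ t : ℝ≥0, t ≤ T + 1 → ∀ ω, ‖((t : ℝ), d - travelledDistance v B t ω)‖ ≤ R := by
    intro t ht ω
    have ht' : (t : ℝ) ≤ T + 1 := by exact_mod_cast ht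
    have h1 := travelledDistance_sub_le hr (fun i => (le_abs_self _).trans (hC i)) ω
      (zero_le (a := t))
    have h2 := travelledDistance_mono hr hv ω (zero_le (a := t))
    simp only [travelledDistance_zero, NNReal.coe_zero, sub_zero] at h1 h2
    have h3 := mul_le_mul_of_nonneg_left ht' hC0
    have h0 := t.2
    have hCT : 0 ≤ C * (T + 1 : ℝ) := by positivity
    have hT0 := T.2
    rw [Prod.norm_mk, Real.norm_eq_abs, Real.norm_eq_abs, NNReal.abs_eq]
    refine max_le (by linarith) (abs_le.2 ⟨by linarith, by linarith⟩)
  have hcpt := isCompact_closedBall (0 : ℝ × ℝ) R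
  obtain ⟨K, hK0, hK, hK'⟩ : ∃ K, 0 ≤ K ∧ (∀ i z, ‖z‖ ≤ R → ‖F i z‖ ≤ K) ∧
      ∀ i z, ‖z‖ ≤ R → ‖fderiv ℝ (F i) z‖ ≤ K := by
    choose K1 hK1 using fun i => hcpt.exists_bound_of_continuousOn (hF0 i).continuousOn
    choose K2 hK2 using fun i => hcpt.exists_bound_of_continuousOn
      ((hF i).continuous_fderiv one_ne_zero).continuousOn
    have hle : ∀ i, |K1 i| + |K2 i| ≤ ∑ i, (|K1 i| + |K2 i|) := fun i =>
      Finset.single_le_sum (f := fun i => |K1 i| + |K2 i|) (fun i _ => by positivity)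
        (Finset.mem_univ i)
    refine ⟨∑ i, (|K1 i| + |K2 i|), Finset.sum_nonneg fun i _ => by positivity,
      fun i z h => ?_, fun i z h => ?_⟩
    · have h1 := hK1 i z (mem_closedBall_zero_iff.2 h)
      linarith [hle i, le_abs_self (K1 i), abs_nonneg (K2 i)]
    · have h1 := hK2 i z (mem_closedBall_zero_iff.2 h)
      linarith [hle i, le_abs_self (K2 i), abs_nonneg (K1 i)]
  let M : ℝ≥0 → Ω → E := fun t ω => F (B t ω) ((t : ℝ), d - travelledDistance v B t ω)
  have hMK : ∀ t ≤ T + 1, ∀ ω, ‖M t ω‖ ≤ K := fun t ht ω => hK _ _ (hz t ht ω)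
  have hMm : ∀ t, StronglyMeasurable (M t) := fun t =>
    stronglyMeasurable_apply (Y := fun i ω => F i ((t : ℝ), d - travelledDistance v B t ω)) (hm t)
      fun i => (hF0 i).stronglyMeasurable.comp_measurable (measurable_const.prodMk
        (measurable_const.sub (measurable_travelledDistance hr (fun u _ => hm u) v)))
  have hMi : ∀ t ≤ T + 1, Integrable (M t) (P s) := fun t ht =>
    Integrable.of_bound (hMm t).aestronglyMeasurable K (Eventually.of_forall (hMK t ht))
  have hgrid : ∀ n ω, gridCeil n (travelTime v B d ω) ≤ T + 1 := fun n ω =>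
    (gridCeil_le n _).trans (add_le_add (hτT ω) (by
      rw [div_le_one (by positivity)]; exact le_add_self))
  let N : ℕ → ℕ := fun n => ⌈((n : ℝ≥0) + 1) * T⌉₊
  -- The step starting at a grid point is taken only if the destination has not been reached by
  -- then, an event decided by the past.
  let A : ℕ → ℕ → Set Ω := fun n k => {ω | (k : ℝ≥0) / ((n : ℝ≥0) + 1) < travelTime v B d ω}
  have hA : ∀ n k : ℕ, MeasurableSet[pastSigma B ((k : ℝ≥0) / ((n : ℝ≥0) + 1))] (A n k) := by
    intro n k
    have : A n k = {ω | d ≤ travelledDistance v B ((k : ℝ≥0) / ((n : ℝ≥0) + 1)) ω}ᶜ := by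
      ext ω
      simp only [A, mem_ofPred_eq, mem_compl_iff, ← travelTime_le_iff hr hv, not_le]
    rw [this]
    refine MeasurableSet.compl (@measurableSet_le _ _ _ _ _ (_) _ _ _ _ _ measurable_const ?_)
    exact @measurable_travelledDistance _ _ B (pastSigma B _) hr _
      (fun u hu => measurable_pastSigma B hu) v
  have hsum : ∀ n ω, M (gridCeil n (travelTime v B d ω)) ω = M 0 ω
      + ∑ k ∈ Finset.range (N n), (A n k).indicator (fun ω =>
        M ((k : ℝ≥0) / ((n : ℝ≥0) + 1) + 1 / ((n : ℝ≥0) + 1)) ω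
          - M ((k : ℝ≥0) / ((n : ℝ≥0) + 1)) ω) ω := by
    intro n ω
    exact apply_gridCeil_eq_sum (fun t => M t ω) n (N n)
      (Nat.ceil_mono (mul_le_mul_right (hτT ω) _))
  have hkT : ∀ n, ∀ k ∈ Finset.range (N n), (k : ℝ≥0) / ((n : ℝ≥0) + 1) ≤ T := fun n k hk =>
    (lt_ceil_mul_iff.1 (Finset.mem_range.1 hk)).le
  have h1n : ∀ n : ℕ, 1 / ((n : ℝ≥0) + 1) ≤ 1 := fun n => by
    rw [div_le_one (by positivity)]; exact le_add_self
  have hA' : ∀ n k, MeasurableSet (A n k) := fun n k => pastSigma_le hm _ _ (hA n k)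
  have hinc : ∀ n, ∀ k ∈ Finset.range (N n), Integrable (fun ω =>
        M ((k : ℝ≥0) / ((n : ℝ≥0) + 1) + 1 / ((n : ℝ≥0) + 1)) ω
          - M ((k : ℝ≥0) / ((n : ℝ≥0) + 1)) ω) (P s) := fun n k hk =>
    (hMi _ (add_le_add (hkT n k hk) (h1n n))).sub (hMi _ ((hkT n k hk).trans le_self_add))
  have hMgi : ∀ n, Integrable (fun ω => M (gridCeil n (travelTime v B d ω)) ω) (P s) := by
    intro n
    simp_rw [hsum]
    exact (hMi 0 zero_le).add (integrable_finsetSum _ fun k hk =>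
      (hinc n k hk).indicator (hA' n k))
  have hlim : ∀ ω, Tendsto (fun n => M (gridCeil n (travelTime v B d ω)) ω) atTop
      (𝓝 (F (B (travelTime v B d ω) ω) ((travelTime v B d ω : ℝ), 0))) := by
    intro ω
    have h1 := tendsto_gridCeil (travelTime v B d ω)
    have h2 := h1.mono_right nhdsWithin_le_nhds
    have h3 : Tendsto (fun n => F (B (travelTime v B d ω) ω)
        ((gridCeil n (travelTime v B d ω) : ℝ),
          d - travelledDistance v B (gridCeil n (travelTime v B d ω)) ω)) atTop
        (𝓝 (F (B (travelTime v B d ω) ω) ((travelTime v B d ω : ℝ),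
          d - travelledDistance v B (travelTime v B d ω) ω))) :=
      ((hF0 _).tendsto _).comp ((NNReal.tendsto_coe.2 h2).prodMk_nhds
        (tendsto_const_nhds.sub (((continuous_travelledDistance hr v ω).tendsto _).comp h2)))
    rw [travelledDistance_travelTime hr hv hd, sub_self] at h3
    refine h3.congr' ?_
    filter_upwards [h1.eventually (hr ω _)] with n hn
    simp only [M, hn]
  have hbound : ∀ n, ∀ᵐ ω ∂(P s), ‖M (gridCeil n (travelTime v B d ω)) ω‖ ≤ K := fun n =>
    Eventually.of_forall fun ω => hMK _ (hgrid n ω) ω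
  -- Measurability of the stopped integrand is inherited from its grid approximations.
  refine ⟨Integrable.of_bound (aestronglyMeasurable_of_tendsto_ae atTop
    (fun n => (hMgi n).aestronglyMeasurable) (Eventually.of_forall hlim)) K
    (Eventually.of_forall fun ω => le_of_tendsto (hlim ω).norm
      (Eventually.of_forall fun n => hMK _ (hgrid n ω) ω)), ?_⟩
  have htend := tendsto_integral_of_dominated_convergence (fun _ => K)
    (fun n => (hMgi n).aestronglyMeasurable) (integrable_const K) hbound
    (Eventually.of_forall hlim)
  refine tendsto_nhds_unique htend ?_
  have hint : ∀ n, ∫ ω, M (gridCeil n (travelTime v B d ω)) ω ∂(P s) = F s (0, d)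
      + ∑ k ∈ Finset.range (N n), ∫ ω in A n k,
        (M ((k : ℝ≥0) / ((n : ℝ≥0) + 1) + 1 / ((n : ℝ≥0) + 1)) ω
          - M ((k : ℝ≥0) / ((n : ℝ≥0) + 1)) ω) ∂(P s) := by
    intro n
    simp_rw [hsum]
    rw [integral_add (hMi 0 zero_le) (integrable_finsetSum _ fun k hk =>
      (hinc n k hk).indicator (hA' n k)), integral_finsetSum _ fun k hk =>
      (hinc n k hk).indicator (hA' n k)]
    congr 1
    · have h1 : M 0 =ᵐ[P s] fun _ => F s (0, d) := by
        filter_upwards [hB.start s] with ω hω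
        simp only [M, hω, travelledDistance_zero, sub_zero, NNReal.coe_zero]
      rw [integral_congr_ae h1, integral_const, probReal_univ, one_smul]
    · exact Finset.sum_congr rfl fun k _ => integral_indicator (hA' n k)
  set L : ℝ := (C + 1) + 2 * K * (C + 1) + 2 * C * K + K with hL
  have hL0 : 0 ≤ L := by positivity
  rw [Metric.tendsto_nhds]
  intro δ hδ
  have hT1 : (0 : ℝ) < T + 1 := by positivity
  -- At most `(T + 1) / h` steps, each costing `ε * h * L`, total `(T + 1) * ε * L`; using `L + 1`
  -- makes this strictly less than `δ`.
  set ε : ℝ := δ / ((T + 1) * (L + 1)) with hεdef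
  have hε : 0 < ε := by positivity
  choose η hη0 hη using fun i => (hF i).exists_norm_sub_sub_fderiv_le R hε
  obtain ⟨η', hη'0, hη'⟩ := exists_pos_le hη0
  obtain ⟨θ, hθ0, hθ⟩ := hp.exists_expansion hε
  have hlim0 : Tendsto (fun n : ℕ => 1 / ((n : ℝ≥0) + 1)) atTop (𝓝 0) :=
    tendsto_one_div_add_atTop_nhds_zero_nat
  have hlim1 : Tendsto (fun n : ℕ => (C + 1) * ((1 / ((n : ℝ≥0) + 1) : ℝ≥0) : ℝ)) atTop
      (𝓝 0) := by
    have := (NNReal.tendsto_coe.2 hlim0).const_mul (C + 1)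
    rwa [NNReal.coe_zero, mul_zero] at this
  filter_upwards [hlim0.eventually (ge_mem_nhds hθ0), hlim1.eventually (ge_mem_nhds hη'0)]
    with n hn1 hn2
  rw [hint n, dist_eq_norm, add_sub_cancel_left]
  have hstep : ∀ k ∈ Finset.range (N n), ‖∫ ω in A n k,
        (M ((k : ℝ≥0) / ((n : ℝ≥0) + 1) + 1 / ((n : ℝ≥0) + 1)) ω
          - M ((k : ℝ≥0) / ((n : ℝ≥0) + 1)) ω) ∂(P s)‖
      ≤ ε * ((1 / ((n : ℝ≥0) + 1) : ℝ≥0) : ℝ) * L := fun k hk =>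
    norm_setIntegral_step_le hm hr hp.nonneg hM hF0 hpde hK hK'
      (fun i z w h1 h2 h3 => hη i z w h1 h2 (h3.trans (hη' i))) hC hC0 hK0 hε.le hn2
      (fun u hu => (hθ u (hu.trans hn1)).1) (hθ _ hn1).2
      (hz _ ((hkT n k hk).trans le_self_add)) (hz _ (add_le_add (hkT n k hk) (h1n n))) (hA n k)
  have hNT : (N n : ℝ) * ((1 / ((n : ℝ≥0) + 1) : ℝ≥0) : ℝ) ≤ T + 1 := by
    have := (gridCeil_le n T).trans (add_le_add_right (h1n n) T)
    rw [gridCeil, div_eq_mul_one_div] at this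
    change (N n : ℝ≥0) * (1 / ((n : ℝ≥0) + 1)) ≤ T + 1 at this
    exact_mod_cast this
  refine (norm_sum_le_of_le _ hstep).trans_lt ?_
  rw [Finset.sum_const, Finset.card_range, nsmul_eq_mul]
  calc (N n : ℝ) * (ε * ((1 / ((n : ℝ≥0) + 1) : ℝ≥0) : ℝ) * L)
      = ((N n : ℝ) * ((1 / ((n : ℝ≥0) + 1) : ℝ≥0) : ℝ)) * (ε * L) := by ring
    _ ≤ (T + 1) * (ε * L) := mul_le_mul_of_nonneg_right hNT (by positivity)
    _ < (T + 1) * (ε * (L + 1)) :=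
        mul_lt_mul_of_pos_left (mul_lt_mul_of_pos_left (lt_add_one L) hε) hT1
    _ = δ := by rw [hεdef]; field_simp

end Dynkin

/-! ### Derivatives of matrix exponentials. -/

section MatrixExponential

variable {n 𝕜 : Type*} [Fintype n] [DecidableEq n] [RCLike 𝕜]

theorem Matrix.hasDerivAt_exp_smul (A : Matrix n n 𝕜) (y : ℝ) :
    HasDerivAt (fun y : ℝ => NormedSpace.exp (y • A)) (A * NormedSpace.exp (y • A)) y := by
  let _ : NormedRing (Matrix n n 𝕜) := Matrix.linftyOpNormedRing
  let _ : NormedAlgebra ℝ (Matrix n n 𝕜) := Matrix.linftyOpNormedAlgebra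
  exact hasDerivAt_exp_smul_const' A y

theorem Matrix.derivWithin_of_eqOn_exp_smul {A : Matrix n n 𝕜} {f : ℝ → Matrix n n 𝕜}
    (hf : ∀ y ∈ Ici (0 : ℝ), f y = NormedSpace.exp (y • A)) {d : ℝ} (hd : 0 ≤ d) :
    DifferentiableWithinAt ℝ f (Ici 0) d ∧ derivWithin f (Ici 0) d = A * f d := by
  let _ : NormedRing (Matrix n n 𝕜) := Matrix.linftyOpNormedRing
  let _ : NormedAlgebra ℝ (Matrix n n 𝕜) := Matrix.linftyOpNormedAlgebra
  have h : HasDerivWithinAt f (A * f d) (Ici 0) d := by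
    rw [hf d hd]
    exact (hasDerivAt_exp_smul_const' A d).hasDerivWithinAt.congr hf (hf d hd)
  exact ⟨h.differentiableWithinAt, h.derivWithin (uniqueDiffOn_Ici 0 d hd)⟩

theorem Matrix.hasDerivAt_exp_smul_apply (A : Matrix n n 𝕜) (y : ℝ) (i j : n) :
    HasDerivAt (fun y : ℝ => NormedSpace.exp (y • A) i j)
      (∑ k, A i k * NormedSpace.exp (y • A) k j) y :=
  hasDerivAt_pi.1 (hasDerivAt_pi.1 (Matrix.hasDerivAt_exp_smul A y) i) j

theorem Matrix.contDiff_exp_smul_apply (A : Matrix n n 𝕜) (i j : n) :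
    ContDiff ℝ 1 fun y : ℝ => NormedSpace.exp (y • A) i j := by
  have h := fun i y => Matrix.hasDerivAt_exp_smul_apply A y i j
  refine contDiff_one_iff_deriv.2 ⟨fun y => (h i y).differentiableAt, ?_⟩
  rw [funext fun y => (h i y).deriv]
  exact continuous_finsetSum _ fun k _ => continuous_const.mul
    (continuous_iff_continuousAt.2 fun y => (h k y).continuousAt)

end MatrixExponential

/-! ### The two choices of `F`. -/

section Applications

variable {Ω I : Type*} [MeasurableSpace Ω] [Fintype I] [DecidableEq I]
  {Q : Matrix I I ℝ} {P : I → Measure Ω} {B : ℝ≥0 → Ω → I} {v : I → ℝ}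

theorem integrable_and_integral_transformIntegrand (hB : IsMarkovProcess Q P B)
    (hv : ∀ s, 0 < v s) (α : ℂ) {d : ℝ} (hd : 0 ≤ d) (s s' : I) :
    Integrable (transformIntegrand v B α d s') (P s) ∧
    ∫ ω, transformIntegrand v B α d s' ω ∂(P s) = NormedSpace.exp (d •
      ((Matrix.diagonal fun s => (v s : ℂ))⁻¹ * (Q.map Complex.ofReal - α • 1))) s s' := by
  set A : Matrix I I ℂ := (Matrix.diagonal fun s => (v s : ℂ))⁻¹ *
    (Q.map Complex.ofReal - α • 1) with hA
  have hv' : ∀ i, (v i : ℂ) ≠ 0 := fun i => Complex.ofReal_ne_zero.2 (hv i).ne'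
  have hVA : (Matrix.diagonal fun s => (v s : ℂ)) * A = Q.map Complex.ofReal - α • 1 := by
    refine Matrix.mul_nonsing_inv_cancel_left _ _ ?_
    rw [Matrix.det_diagonal]
    exact (Finset.prod_ne_zero_iff.2 fun s _ => hv' s).isUnit
  -- The equation for `F` reduces to `hVA`. At `y = 0` the exponential is the identity, whose `(i,
  -- s')` entry is the indicator of `i = s'`.
  let F : I → ℝ × ℝ → ℂ := fun i z =>
    Complex.exp (-α * (z.1 : ℂ)) * NormedSpace.exp (z.2 • A) i s'
  have hexp : ∀ t : ℝ, HasDerivAt (fun t : ℝ => Complex.exp (-α * (t : ℂ)))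
      (Complex.exp (-α * (t : ℂ)) * (-α)) t := fun t => by
    have h1 := ((Complex.ofRealCLM.hasDerivAt (x := t)).const_mul (-α)).cexp
    simpa using h1
  have hF : ∀ i, ContDiff ℝ 1 (F i) := fun i =>
    (Complex.contDiff_exp.comp (contDiff_const.mul
      (Complex.ofRealCLM.contDiff.comp contDiff_fst))).mul
        ((Matrix.contDiff_exp_smul_apply A i s').comp contDiff_snd)
  have hpde : ∀ i z, fderiv ℝ (F i) z (1, -v i) + ∑ j, Q i j • F j z = 0 := by
    intro i z
    have h1 := ((hexp z.1).hasFDerivAt.comp z hasFDerivAt_fst).mul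
      ((Matrix.hasDerivAt_exp_smul_apply A z.2 i s').hasFDerivAt.comp z hasFDerivAt_snd)
    have h2 : fderiv ℝ (F i) z (1, -v i) = Complex.exp (-α * (z.1 : ℂ)) *
        (-v i * ∑ k, A i k * NormedSpace.exp (z.2 • A) k s') +
        NormedSpace.exp (z.2 • A) i s' * (Complex.exp (-α * (z.1 : ℂ)) * (-α)) := by
      have h3 : HasFDerivAt (F i) _ z := h1
      rw [h3.fderiv]
      simp
    have h4 : (v i : ℂ) * ∑ k, A i k * NormedSpace.exp (z.2 • A) k s'
        = ∑ k, (Q i k : ℂ) * NormedSpace.exp (z.2 • A) k s'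
          - α * NormedSpace.exp (z.2 • A) i s' := by
      have h5 : ∀ k, (v i : ℂ) * A i k = Q i k - α * (1 : Matrix I I ℂ) i k := fun k => by
        rw [← Matrix.diagonal_mul (fun s => (v s : ℂ)), hVA]
        simp
      simp only [Finset.mul_sum, ← mul_assoc, h5, sub_mul, Finset.sum_sub_distrib]
      simp [Matrix.one_apply]
    have h6 : ∑ j, Q i j • F j z = Complex.exp (-α * (z.1 : ℂ)) *
        ∑ k, (Q i k : ℂ) * NormedSpace.exp (z.2 • A) k s' := by
      rw [Finset.mul_sum]
      refine Finset.sum_congr rfl fun k _ => ?_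
      simp only [F, Complex.real_smul]
      ring
    rw [h2, h6]
    linear_combination -Complex.exp (-α * (z.1 : ℂ)) * h4
  have key := integrable_and_integral_travelTime_eq hB hv hF hpde hd s
  have hfun : (fun ω => F (B (travelTime v B d ω) ω) ((travelTime v B d ω : ℝ), 0))
      = transformIntegrand v B α d s' := by
    ext ω
    simp only [F, transformIntegrand, zero_smul, NormedSpace.exp_zero, Matrix.one_apply,
      Set.indicator_apply, Set.mem_ofPred_eq]
    split_ifs <;> simp
  have hfun' := fun ω => congrFun hfun ω
  simp only [hfun'] at key
  refine ⟨key.1, key.2.trans ?_⟩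
  simp [F]

/-- The block matrix whose exponential gives the expected travel times. -/
noncomputable def travelTimeMatrix (Q : Matrix I I ℝ) (v : I → ℝ) :
    Matrix (I ⊕ Unit) (I ⊕ Unit) ℝ :=
  Matrix.fromBlocks ((Matrix.diagonal v)⁻¹ * Q)
    ((Matrix.diagonal v)⁻¹ * Matrix.replicateCol Unit (1 : I → ℝ)) 0 0

/-- The bottom row of `travelTimeMatrix` is zero, so this entry keeps its value at `y = 0`. It
supplies the inhomogeneous term `1` in the equation for the last column. -/
theorem exp_smul_travelTimeMatrix_inr (Q : Matrix I I ℝ) (v : I → ℝ) (y : ℝ) :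
    NormedSpace.exp (y • travelTimeMatrix Q v) (Sum.inr ()) (Sum.inr ()) = 1 := by
  have h : ∀ y, HasDerivAt (fun y : ℝ =>
      NormedSpace.exp (y • travelTimeMatrix Q v) (Sum.inr ()) (Sum.inr ())) 0 y := fun y => by
    refine (Matrix.hasDerivAt_exp_smul_apply (travelTimeMatrix Q v) y _ _).congr_deriv ?_
    refine Finset.sum_eq_zero fun k _ => ?_
    cases k <;> simp [travelTimeMatrix]
  have h1 := is_const_of_deriv_eq_zero (fun y => (h y).differentiableAt)
    (fun y => (h y).deriv) y 0
  rw [h1, zero_smul, NormedSpace.exp_zero, Matrix.one_apply_eq]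

theorem hasDerivAt_exp_smul_travelTimeMatrix (Q : Matrix I I ℝ) (hv : ∀ s, 0 < v s) (y : ℝ)
    (i : I) :
    HasDerivAt (fun y : ℝ =>
      NormedSpace.exp (y • travelTimeMatrix Q v) (Sum.inl i) (Sum.inr ()))
      ((v i)⁻¹ * (1 + ∑ j, Q i j *
        NormedSpace.exp (y • travelTimeMatrix Q v) (Sum.inl j) (Sum.inr ()))) y := by
  refine (Matrix.hasDerivAt_exp_smul_apply (travelTimeMatrix Q v) y _ _).congr_deriv ?_
  rw [Fintype.sum_sum_type]
  simp only [Finset.univ_unique, PUnit.default_eq_unit, Finset.sum_singleton,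
    exp_smul_travelTimeMatrix_inr]
  have hinv : (Matrix.diagonal v)⁻¹ = Matrix.diagonal fun i => (v i)⁻¹ := by
    refine Matrix.inv_eq_right_inv ?_
    rw [Matrix.diagonal_mul_diagonal, ← Matrix.diagonal_one]
    exact congrArg _ (funext fun i => mul_inv_cancel₀ (hv i).ne')
  simp only [travelTimeMatrix, hinv, Matrix.fromBlocks_apply₁₁, Matrix.fromBlocks_apply₁₂,
    Matrix.diagonal_mul, Matrix.replicateCol_apply, Pi.one_apply, mul_add, Finset.mul_sum]
  rw [add_comm, mul_one]
  simp only [mul_assoc, mul_one]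

theorem integrable_and_integral_travelTime (hB : IsMarkovProcess Q P B)
    (hv : ∀ s, 0 < v s) {d : ℝ} (hd : 0 ≤ d) (s : I) :
    Integrable (fun ω => (travelTime v B d ω : ℝ)) (P s) ∧
    ∫ ω, (travelTime v B d ω : ℝ) ∂(P s)
      = NormedSpace.exp (d • travelTimeMatrix Q v) (Sum.inl s) (Sum.inr ()) := by
  -- The derivative in `t` gives `1`, matching the inhomogeneous term; at `y = 0` the exponential
  -- contributes an off-diagonal entry of the identity, leaving `τ`.
  let F : I → ℝ × ℝ → ℝ := fun i z =>
    z.1 + NormedSpace.exp (z.2 • travelTimeMatrix Q v) (Sum.inl i) (Sum.inr ())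
  have hF : ∀ i, ContDiff ℝ 1 (F i) := fun i =>
    contDiff_fst.add ((Matrix.contDiff_exp_smul_apply _ _ _).comp contDiff_snd)
  have hpde : ∀ i z, fderiv ℝ (F i) z (1, -v i) + ∑ j, Q i j • F j z = 0 := by
    intro i z
    obtain ⟨p, hp, -⟩ := hB.markov
    have h1 : HasFDerivAt (F i) _ z := hasFDerivAt_fst.add
      ((hasDerivAt_exp_smul_travelTimeMatrix Q hv z.2 i).hasFDerivAt.comp z hasFDerivAt_snd)
    have h2 : ∑ j, Q i j * z.1 = 0 := by
      rw [← Finset.sum_mul, hp.row_sum_generator, zero_mul]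
    rw [h1.fderiv]
    simp only [F, smul_eq_mul, mul_add, Finset.sum_add_distrib, h2]
    have h3 := (hv i).ne'
    simp
    field_simp
    ring
  have key := integrable_and_integral_travelTime_eq hB hv hF hpde hd s
  simpa [F] using key

end Applications

theorem theorem1 {Ω I : Type*} [MeasurableSpace Ω] [Fintype I] [DecidableEq I]
    (Q : Matrix I I ℝ) (P : I → Measure Ω) (B : ℝ≥0 → Ω → I) (hB : IsMarkovProcess Q P B)
    (v : I → ℝ) (hv : ∀ s, 0 < v s) :
    -- the minimum and the expectations that define the travel time, `Φ` and `Ψ` exist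
    (∀ d : ℝ, 0 ≤ d → ∀ ω,
      IsLeast {t : ℝ≥0 | d ≤ travelledDistance v B t ω} (travelTime v B d ω)) ∧
    (∀ d : ℝ, 0 ≤ d → ∀ s, Integrable (fun ω => (travelTime v B d ω : ℝ)) (P s)) ∧
    (∀ (α : ℂ) (d : ℝ), 0 ≤ d → ∀ s s', Integrable (transformIntegrand v B α d s') (P s)) ∧
    -- the differential equations
    (∀ d : ℝ, 0 ≤ d →
      DifferentiableWithinAt ℝ (Phi P v B) (Ici 0) d ∧
      Matrix.diagonal v *ᵥ derivWithin (Phi P v B) (Ici 0) d = 1 + Q *ᵥ Phi P v B d) ∧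
    (∀ (α : ℂ) (d : ℝ), 0 ≤ d →
      DifferentiableWithinAt ℝ (Psi P v B α) (Ici 0) d ∧
      Matrix.diagonal (fun s => (v s : ℂ)) * derivWithin (Psi P v B α) (Ici 0) d
        = (Q.map Complex.ofReal - α • 1) * Psi P v B α d) ∧
    -- the explicit solutions
    (∀ d : ℝ, 0 ≤ d → ∀ s, Phi P v B d s =
      (NormedSpace.exp (Matrix.fromBlocks
          (d • ((Matrix.diagonal v)⁻¹ * Q))
          (d • ((Matrix.diagonal v)⁻¹ * Matrix.replicateCol Unit (1 : I → ℝ)))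
          (0 : Matrix Unit I ℝ) (0 : Matrix Unit Unit ℝ)) *ᵥ
        Sum.elim (0 : I → ℝ) (1 : Unit → ℝ)) (Sum.inl s)) ∧
    (∀ (α : ℂ) (d : ℝ), 0 ≤ d → Psi P v B α d =
      NormedSpace.exp ((d : ℂ) • ((Matrix.diagonal (fun s => (v s : ℂ)))⁻¹ *
        (Q.map Complex.ofReal - α • 1)))) := by
  have hr := hB.right_continuous
  refine ⟨fun d _ ω => isLeast_travelTime hr hv d ω,
    fun d hd s => (integrable_and_integral_travelTime hB hv hd s).1,
    fun α d hd s s' => (integrable_and_integral_transformIntegrand hB hv α hd s s').1,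
    fun d hd => ?_, fun α d hd => ?_, fun d hd s => ?_, fun α d hd => ?_⟩
  -- The formula for `Φ` is available only for `d ≥ 0`, hence derivatives within `Ici 0`, one-sided
  -- at `0`.
  · have h : HasDerivWithinAt (Phi P v B)
        (fun s => (v s)⁻¹ * (1 + ∑ j, Q s j * Phi P v B d j)) (Ici 0) d := by
      refine hasDerivWithinAt_pi.2 fun s => ?_
      have h1 := (hasDerivAt_exp_smul_travelTimeMatrix Q hv d s).hasDerivWithinAt
        (s := Ici (0 : ℝ))
      refine (h1.congr_deriv ?_).congr
        (fun y hy => (integrable_and_integral_travelTime hB hv hy s).2)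
        (integrable_and_integral_travelTime hB hv hd s).2
      congr 2
      exact Finset.sum_congr rfl fun j _ => by
        rw [Phi, (integrable_and_integral_travelTime hB hv hd j).2]
    refine ⟨h.differentiableWithinAt, ?_⟩
    rw [h.derivWithin (uniqueDiffOn_Ici 0 d hd)]
    ext s
    rw [Matrix.mulVec_diagonal, mul_inv_cancel_left₀ (hv s).ne']
    rfl
  · have hPsi : ∀ y ∈ Ici (0 : ℝ), Psi P v B α y = NormedSpace.exp (y •
        ((Matrix.diagonal fun s => (v s : ℂ))⁻¹ * (Q.map Complex.ofReal - α • 1))) := by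
      intro y hy
      ext s s'
      exact (integrable_and_integral_transformIntegrand hB hv α hy s s').2
    obtain ⟨h1, h2⟩ := Matrix.derivWithin_of_eqOn_exp_smul hPsi hd
    refine ⟨h1, ?_⟩
    rw [h2, ← Matrix.mul_assoc, Matrix.mul_nonsing_inv_cancel_left]
    rw [Matrix.det_diagonal]
    exact (Finset.prod_ne_zero_iff.2 fun s _ => Complex.ofReal_ne_zero.2 (hv s).ne').isUnit
  · rw [Phi, (integrable_and_integral_travelTime hB hv hd s).2, travelTimeMatrix,
      Matrix.fromBlocks_smul, smul_zero, smul_zero]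
    simp [Matrix.mulVec, dotProduct]
  · ext s s'
    rw [Complex.coe_smul]
    exact (integrable_and_integral_transformIntegrand hB hv α hd s s').2
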